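/- Let $\mathbb D$ be the open unit disk of $\mathbb C$. For $1\le p<\infty$ let $H^p$ be the Hardy space of holomorphic functions $f$ on $\mathbb D$ with $$\|f\|_{H^p}=\sup_{0<r<1}\Big(\int_{\mathbb T}|f(r\zeta)|^p\,d\lambda(\zeta)\Big)^{1/p}<\infty ,$$ where $\lambda$ is the normalized Haar measure on the unit circle $\mathbb T$. For $n\ge 0$ and $0\le j<2^n$ let $$R_{n,j}=\Big\{z\in\mathbb D:\ 1-2^{-n}\le |z|<1-2^{-n-1},\ \arg z\in\big(2\pi j/2^n,\,2\pi (j+1)/2^n\big]\Big\}$$ (the argument being taken in $(0,2\pi]$, and $0\in R_{0,0}$). A bounded operator $T:X\to Y$ between normed spaces is called $r$-summing ($1\le r<\infty$) if there is a constant $C\ge 0$ such that $$\Big(\sum_{k=1}^N\|Tx_k\|^r\Big)^{1/r}\le C\sup_{\|x^*\|_{X^*}\le 1}\Big(\sum_{k=1}^N|\langle x^*,x_k\rangle|^r\Big)^{1/r}$$ for every finite sequence $x_1,\dots,x_N$ in $X$. Let $p>2$ and let $p'$ be its conjugate exponent, $\frac1p+\frac1{p'}=1$. Then there is a finite positive Borel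 measure $\mu$ on $\mathbb D$, carried by the segment $[0,1)$ (that is, $\mu(\mathbb D\setminus[0,1))=0$), such that $$\Bigg[\sum_{n\ge 0}\Big(\sum_{j=0}^{2^n-1}\big(2^n\mu(R_{n,j})\big)^{p'/p}\Big)^{2/p'}\Bigg]^{1/2}<+\infty ,$$ and such that the embedding $J_\mu:H^p\to L^p(\mu)$, $f\mapsto f$, is a well-defined bounded operator but is not $p'$-summing. -/

import Mathlib

open MeasureTheory Metric Set
open scoped ENNReal NNReal

noncomputable section

/-- The `H^p` norm of `f`, as an extended real: the supremum over `0 < r < 1` of the `L^p` norm of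
`f_r : ζ ↦ f (r ζ)` on the unit circle, for the normalized Haar measure. -/
def hardyENorm (p : ℝ≥0∞) (f : ℂ → ℂ) : ℝ≥0∞ :=
  ⨆ r ∈ Ioo (0 : ℝ) 1,
    eLpNorm (fun t : UnitAddCircle => f ((r : ℂ) * (AddCircle.toCircle t : ℂ))) p
      AddCircle.haarAddCircle

theorem hardy_dilate_continuous {f : ℂ → ℂ} (hf : DifferentiableOn ℂ f (ball 0 1)) {r : ℝ}
    (hr : r ∈ Ioo (0 : ℝ) 1) :
    Continuous (fun t : UnitAddCircle => f ((r : ℂ) * (AddCircle.toCircle t : ℂ))) := by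
  refine hf.continuousOn.comp_continuous (s := ball 0 1) ?_ ?_
  · have := AddCircle.continuous_toCircle (T := (1 : ℝ))
    fun_prop
  · intro t
    have h1 : ‖(AddCircle.toCircle t : ℂ)‖ = 1 := Circle.norm_coe _
    simp [abs_of_pos hr.1, hr.2, h1]

theorem hardyENorm_add_le {p : ℝ≥0∞} (hp : 1 ≤ p) {f g : ℂ → ℂ}
    (hf : DifferentiableOn ℂ f (ball 0 1)) (hg : DifferentiableOn ℂ g (ball 0 1)) :
    hardyENorm p (f + g) ≤ hardyENorm p f + hardyENorm p g := by
  refine iSup₂_le fun r hr => ?_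
  refine le_trans (eLpNorm_add_le (hardy_dilate_continuous hf hr).aestronglyMeasurable
    (hardy_dilate_continuous hg hr).aestronglyMeasurable hp) ?_
  exact add_le_add
    (le_iSup₂ (f := fun (r : ℝ) (_ : r ∈ Ioo (0 : ℝ) 1) => eLpNorm (fun t : UnitAddCircle =>
      f ((r : ℂ) * (AddCircle.toCircle t : ℂ))) p AddCircle.haarAddCircle) r hr)
    (le_iSup₂ (f := fun (r : ℝ) (_ : r ∈ Ioo (0 : ℝ) 1) => eLpNorm (fun t : UnitAddCircle =>
      g ((r : ℂ) * (AddCircle.toCircle t : ℂ))) p AddCircle.haarAddCircle) r hr)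

theorem hardyENorm_smul (p : ℝ≥0∞) (c : ℂ) (f : ℂ → ℂ) :
    hardyENorm p (c • f) = ‖c‖ₑ * hardyENorm p f := by
  simp only [hardyENorm, ENNReal.mul_iSup]
  refine iSup_congr fun r => iSup_congr fun _ => ?_
  exact eLpNorm_const_smul c
    (fun t : UnitAddCircle => f ((r : ℂ) * (AddCircle.toCircle t : ℂ))) p
    AddCircle.haarAddCircle

theorem hardyENorm_zero (p : ℝ≥0∞) : hardyENorm p 0 = 0 := by
  simp [hardyENorm]

theorem hardyENorm_eq_zero {p : ℝ≥0∞} (hp : 1 ≤ p) {f : ℂ → ℂ}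
    (hf : DifferentiableOn ℂ f (ball 0 1)) (h0 : hardyENorm p f = 0) :
    ∀ z ∈ ball (0 : ℂ) 1, f z = 0 := by
  have key : ∀ z ∈ ball (0 : ℂ) 1, z ≠ 0 → f z = 0 := by
    intro z hz hz0
    have hr : ‖z‖ ∈ Ioo (0 : ℝ) 1 := ⟨norm_pos_iff.2 hz0, by simpa using hz⟩
    have h1 := h0
    simp only [hardyENorm, ENNReal.iSup_eq_zero] at h1
    have h2 := h1 ‖z‖ hr
    rw [eLpNorm_eq_zero_iff (hardy_dilate_continuous hf hr).aestronglyMeasurable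
      (by positivity)] at h2
    have h3 := Continuous.ae_eq_iff_eq AddCircle.haarAddCircle (hardy_dilate_continuous hf hr)
      continuous_zero |>.1 h2
    have hc : z / (‖z‖ : ℂ) ∈ Submonoid.unitSphere ℂ := by
      change z / (‖z‖ : ℂ) ∈ sphere (0 : ℂ) 1
      simp [hz0]
    obtain ⟨t, ht⟩ := (AddCircle.homeomorphCircle (one_ne_zero (α := ℝ))).surjective
      (⟨z / (‖z‖ : ℂ), hc⟩ : Circle)
    have h4 := congrFun h3 t
    rw [AddCircle.homeomorphCircle_apply] at ht
    rw [ht] at h4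
    have h5 : (‖z‖ : ℂ) * (z / (‖z‖ : ℂ)) = z := by
      have : (‖z‖ : ℂ) ≠ 0 := by simpa using hz0
      field_simp
    simpa [h5] using h4
  intro z hz
  by_cases hz0 : z = 0
  · subst hz0
    have hcont : ContinuousAt f 0 :=
      hf.continuousOn.continuousAt (isOpen_ball.mem_nhds hz)
    have h1 : Filter.Tendsto f (nhdsWithin 0 {0}ᶜ) (nhds (f 0)) :=
      hcont.tendsto.mono_left nhdsWithin_le_nhds
    have h2 : f =ᶠ[nhdsWithin 0 {0}ᶜ] fun _ => 0 := by
      filter_upwards [self_mem_nhdsWithin,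
        mem_nhdsWithin_of_mem_nhds (isOpen_ball.mem_nhds hz)] with w hw hw'
      exact key w hw' hw
    exact tendsto_nhds_unique (h1.congr' h2) tendsto_const_nhds
  · exact key z hz hz0

/-- The holomorphic functions on the open unit disk with finite `H^p` norm. A function on the disk
is represented by its extension by `0` to `ℂ`. -/
def hardySubmodule (p : ℝ≥0∞) [Fact (1 ≤ p)] : Submodule ℂ (ℂ → ℂ) where
  carrier := {f | DifferentiableOn ℂ f (ball 0 1) ∧ (∀ z ∉ ball (0 : ℂ) 1, f z = 0) ∧
    hardyENorm p f < ∞}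
  add_mem' := by
    rintro f g ⟨hf, hf0, hf1⟩ ⟨hg, hg0, hg1⟩
    exact ⟨hf.add hg, fun z hz => by simp [hf0 z hz, hg0 z hz],
      (hardyENorm_add_le Fact.out hf hg).trans_lt (ENNReal.add_lt_top.2 ⟨hf1, hg1⟩)⟩
  zero_mem' := ⟨differentiableOn_const 0, fun _ _ => rfl, by simp [hardyENorm_zero]⟩
  smul_mem' := by
    rintro c f ⟨hf, hf0, hf1⟩
    refine ⟨hf.const_smul c, fun z hz => by simp [hf0 z hz], ?_⟩
    rw [hardyENorm_smul]
    exact ENNReal.mul_lt_top enorm_lt_top hf1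

/-- The Hardy space `H^p` of the unit disk. -/
def HardySpace (p : ℝ≥0∞) [Fact (1 ≤ p)] : Type := ↥(hardySubmodule p)

namespace HardySpace

variable {p : ℝ≥0∞} [Fact (1 ≤ p)]

instance : AddCommGroup (HardySpace p) := inferInstanceAs (AddCommGroup ↥(hardySubmodule p))

instance : Module ℂ (HardySpace p) := inferInstanceAs (Module ℂ ↥(hardySubmodule p))

/-- The underlying function (zero outside the unit disk). -/
def toFun (f : HardySpace p) : ℂ → ℂ := Subtype.val f

instance : CoeFun (HardySpace p) (fun _ => ℂ → ℂ) := ⟨toFun⟩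

instance : Norm (HardySpace p) := ⟨fun f => (hardyENorm p f).toReal⟩

theorem normedSpaceCore : NormedSpace.Core ℂ (HardySpace p) where
  norm_nonneg _ := ENNReal.toReal_nonneg
  norm_smul c f := by
    change (hardyENorm p (c • f.toFun)).toReal = ‖c‖ * (hardyENorm p f.toFun).toReal
    rw [hardyENorm_smul, ENNReal.toReal_mul, toReal_enorm]
  norm_triangle f g := by
    change (hardyENorm p (f.toFun + g.toFun)).toReal ≤
      (hardyENorm p f.toFun).toReal + (hardyENorm p g.toFun).toReal
    obtain ⟨hf, -, hf1⟩ := f.property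
    obtain ⟨hg, -, hg1⟩ := g.property
    refine (ENNReal.toReal_mono (ENNReal.add_lt_top.2 ⟨hf1, hg1⟩).ne
      (hardyENorm_add_le Fact.out hf hg)).trans_eq ?_
    exact ENNReal.toReal_add hf1.ne hg1.ne
  norm_eq_zero_iff f := by
    obtain ⟨hf, hf0, hf1⟩ := f.property
    change (hardyENorm p f.toFun).toReal = 0 ↔ f = 0
    constructor
    · intro h
      have h1 : hardyENorm p f.toFun = 0 :=
        ((ENNReal.toReal_eq_zero_iff _).1 h).resolve_right hf1.ne
      refine Subtype.ext (funext fun z => ?_)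
      by_cases hz : z ∈ ball (0 : ℂ) 1
      · exact hardyENorm_eq_zero Fact.out hf h1 z hz
      · exact hf0 z hz
    · rintro rfl
      change (hardyENorm p 0).toReal = 0
      simp [hardyENorm_zero]

instance : NormedAddCommGroup (HardySpace p) := NormedAddCommGroup.ofCore normedSpaceCore

instance : NormedSpace ℂ (HardySpace p) := NormedSpace.ofCore normedSpaceCore

end HardySpace

/-- A bounded operator `T : X → Y` is `r`-summing if there is a constant `C` such that
`(∑ ‖T x_j‖ ^ r) ^ (1/r) ≤ C * sup (∑ |φ x_j| ^ r) ^ (1/r)` for every finite sequence in `X`,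
where `φ` runs over the closed unit ball of the dual of `X`. -/
def IsSumming {X Y : Type*} [NormedAddCommGroup X] [NormedSpace ℂ X] [NormedAddCommGroup Y]
    [NormedSpace ℂ Y] (r : ℝ) (T : X →L[ℂ] Y) : Prop :=
  ∃ C : ℝ≥0, ∀ (n : ℕ) (x : Fin n → X),
    (∑ j, ‖T (x j)‖ₑ ^ r) ^ (1 / r) ≤
      C * ⨆ φ ∈ closedBall (0 : StrongDual ℂ X) 1, (∑ j, ‖φ (x j)‖ₑ ^ r) ^ (1 / r)

/-- The bounded operator `J` is the Carleson embedding `J_μ : H^p → L^p(μ)`, `f ↦ f`. -/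
def IsCarlesonEmbedding {p : ℝ≥0∞} [Fact (1 ≤ p)] {μ : Measure ℂ}
    (J : HardySpace p →L[ℂ] Lp ℂ p μ) : Prop :=
  ∀ f : HardySpace p, J f =ᵐ[μ] f

/-- The Luecking box `R_{n,j}`: `1 - 2^{-n} ≤ |z| < 1 - 2^{-n-1}` and `z` has an argument in
`(2πj/2^n, 2π(j+1)/2^n]`. -/
def lueckingBox (n j : ℕ) : Set ℂ :=
  {z | 1 - 1 / (2 : ℝ) ^ n ≤ ‖z‖ ∧ ‖z‖ < 1 - 1 / (2 : ℝ) ^ (n + 1) ∧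
    ∃ θ ∈ Ioc (2 * Real.pi * j / 2 ^ n) (2 * Real.pi * (j + 1) / 2 ^ n),
      z = (‖z‖ : ℂ) * Complex.exp (θ * Complex.I)}

end

/-! Write `q` for the conjugate exponent of `p`. The measure is `μ = ∑ (n+1)^{-p/q} 2^{-n} δ_{s_n}`
with `s_n = 1 - 2^{-n}`. At level `n` only the last box meets `[0,1)`, and `2^n μ` of it is at most
`(n+1)^{-p/q}`. The box sum is therefore dominated by `∑ (n+1)^{-2/q}`, finite because `q < 2`.

Boundedness comes from the growth estimate `|f(s_n)| ≤ K 2^{n/p} ‖f‖`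
(`enorm_apply_dyadicRadius_le`): the factor `2^{-n}` cancels and `∑ (n+1)^{-p/q}` remains, with `p/q
= p - 1 > 1`.

Summability is tested on the Szegő kernels `g_k(z) = 2^{-k/q} / (1 - s_k z)`. They are spread over
separate dyadic scales near `1`, and this gives an upper `ℓ^p` estimate `‖∑ c_k g_k‖ ≤ K ‖c‖_p`
(`hardyENorm_sum_szegoKernel_le`). By duality their weak `ℓ^q` norms are bounded
(`sum_enorm_dual_apply_rpow_le`). The atom at `s_k` alone gives `‖J g_k‖^q ≥ 2^{-q} / (k+1)`, so a
summing inequality would bound the harmonic series. -/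

/-! ### Integrals over the circle and size of the Cauchy kernel -/

/-- Split at `x = 1/M`, where the two entries of the minimum agree; `b < 1` gives convergence at `0`
and `a + b > 1` at infinity. The cases needed are `(a, b) = (q, 0)` for point evaluations and `(1,
1/q)` for sums of kernels. -/
theorem lintegral_Ioi_min_rpow_le {M a b : ℝ} (hM : 0 < M) (hb : b < 1) (hab : 1 < a + b) :
    ∫⁻ x in Ioi (0 : ℝ), ENNReal.ofReal (min M (1 / x) ^ a * x ^ (-b)) ≤
      ENNReal.ofReal (M ^ (a + b - 1) * (1 / (1 - b) + 1 / (a + b - 1))) := by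
  have hM' : 0 < 1 / M := by positivity
  have ha : 0 < a := by linarith
  rw [← Ioc_union_Ioi_eq_Ioi hM'.le, mul_add, ENNReal.ofReal_add
    (mul_nonneg (by positivity) (one_div_nonneg.2 (by linarith)))
    (mul_nonneg (by positivity) (one_div_nonneg.2 (by linarith)))]
  refine (lintegral_union_le _ _ _).trans (add_le_add ?_ ?_)
  · have h1 : IntegrableOn (fun x : ℝ => M ^ a * x ^ (-b)) (Ioc 0 (1 / M)) :=
      (((intervalIntegrable_iff_integrableOn_Ioc_of_le hM'.le).1
        (intervalIntegral.intervalIntegrable_rpow' (by linarith))).const_mul _)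
    have h2 : ∫ x in Ioc 0 (1 / M), M ^ a * x ^ (-b) = M ^ (a + b - 1) * (1 / (1 - b)) := by
      rw [← intervalIntegral.integral_of_le hM'.le, intervalIntegral.integral_const_mul,
        integral_rpow (Or.inl (by linarith)), Real.zero_rpow (by linarith), sub_zero, one_div,
        Real.inv_rpow hM.le, ← Real.rpow_neg hM.le, ← mul_div_assoc, ← Real.rpow_add hM]
      rw [show a + -(-b + 1) = a + b - 1 by ring, show -b + 1 = 1 - b by ring]
      ring
    rw [← h2, ofReal_integral_eq_lintegral_ofReal h1
      ((ae_restrict_iff' measurableSet_Ioc).2 (.of_forall fun x hx => by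
        have := hx.1; simp only [Pi.zero_apply]; positivity))]
    refine setLIntegral_mono' measurableSet_Ioc fun x hx => ENNReal.ofReal_le_ofReal ?_
    have hx0 := hx.1
    gcongr
    exact min_le_left _ _
  · have h1 : IntegrableOn (fun x : ℝ => x ^ (-(a + b))) (Ioi (1 / M)) :=
      integrableOn_Ioi_rpow_of_lt (by linarith) hM'
    have h2 : ∫ x in Ioi (1 / M), x ^ (-(a + b)) = M ^ (a + b - 1) * (1 / (a + b - 1)) := by
      rw [integral_Ioi_rpow_of_lt (by linarith) hM', one_div,
        Real.inv_rpow hM.le, ← Real.rpow_neg hM.le, show -(-(a + b) + 1) = a + b - 1 by ring,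
        show -(a + b) + 1 = -(a + b - 1) by ring, neg_div_neg_eq]
      ring
    rw [← h2, ofReal_integral_eq_lintegral_ofReal h1
      ((ae_restrict_iff' measurableSet_Ioi).2 (.of_forall fun x hx => by
        have := hM'.trans hx; simp only [Pi.zero_apply]; positivity))]
    refine setLIntegral_mono' measurableSet_Ioi fun x hx => ENNReal.ofReal_le_ofReal ?_
    have hx0 : 0 < x := hM'.trans hx
    calc min M (1 / x) ^ a * x ^ (-b) ≤ (1 / x) ^ a * x ^ (-b) := by
          gcongr
          exact min_le_right _ _
      _ = x ^ (-(a + b)) := by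
          rw [one_div, Real.inv_rpow hx0.le, ← Real.rpow_neg hx0.le, ← Real.rpow_add hx0]
          congr 1; ring

/-- Reduces circle integrals to the half-line through the fundamental domain `(-1/2, 1/2]`, folded
at `0`. The null point `0` is left out because the majorants have the form `1/|t|`. -/
theorem lintegral_haarAddCircle_le {H : UnitAddCircle → ℝ≥0∞} {F : ℝ → ℝ≥0∞}
    (h : ∀ t ∈ Ioc (-(1 / 2) : ℝ) (1 / 2), t ≠ 0 → H t ≤ F |t|) :
    ∫⁻ t, H t ∂AddCircle.haarAddCircle ≤ 2 * ∫⁻ x in Ioi (0 : ℝ), F x := by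
  have hv : (AddCircle.haarAddCircle : Measure UnitAddCircle) = volume := by
    rw [AddCircle.volume_eq_smul_haarAddCircle]; simp
  rw [hv, ← UnitAddCircle.lintegral_preimage (-(1 / 2)), two_mul]
  have hF : ∫⁻ x in Iio (0 : ℝ), F |x| = ∫⁻ x in Ioi (0 : ℝ), F x := by
    rw [← lintegral_indicator measurableSet_Iio, ← lintegral_indicator measurableSet_Ioi,
      ← lintegral_neg_eq_self]
    refine lintegral_congr fun x => ?_
    by_cases hx : 0 < x
    · simp [hx, abs_of_pos hx]
    · simp [hx]
  have hF' : ∫⁻ x in Ioi (0 : ℝ), F |x| = ∫⁻ x in Ioi (0 : ℝ), F x :=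
    setLIntegral_congr_fun measurableSet_Ioi fun x hx => by simp only [abs_of_pos (mem_Ioi.1 hx)]
  calc _ ≤ ∫⁻ t in Ioc (-(1 / 2) : ℝ) (-(1 / 2) + 1), F |t| := by
        refine lintegral_mono_ae ((ae_restrict_iff' measurableSet_Ioc).2 ?_)
        filter_upwards [Measure.ae_ne volume (0 : ℝ)] with t ht0 ht
        exact h t ⟨ht.1, ht.2.trans (by norm_num)⟩ ht0
    _ ≤ ∫⁻ t in Iio (0 : ℝ) ∪ Ioi 0, F |t| := by
        refine lintegral_mono' ?_ le_rfl
        rw [Iio_union_Ioi, Measure.restrict_eq_self_of_ae_mem (s := {0}ᶜ) (Measure.ae_ne volume 0)]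
        exact Measure.restrict_le_self
    _ ≤ _ := (lintegral_union_le _ _ _).trans_eq (by rw [hF, hF'])

/-- Both `1 - s` and the difference between `1 - w` and `1 - s w` are controlled by `‖1 - s w‖`.
Decay in the angle is thus uniform in the radius. -/
theorem norm_one_sub_le_two_mul {s : ℝ} (hs : s ∈ Icc (0 : ℝ) 1) {w : ℂ} (hw : ‖w‖ = 1) :
    ‖1 - w‖ ≤ 2 * ‖1 - s * w‖ := by
  have h1 : 1 - s ≤ ‖1 - s * w‖ := by
    have := norm_sub_norm_le (1 : ℂ) (s * w)
    simpa [hw, abs_of_nonneg hs.1] using this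
  have h2 : ‖1 - w‖ ≤ ‖1 - s * w‖ + ‖((1 - s : ℝ) : ℂ) * w‖ := by
    refine (norm_sub_le _ _).trans' (le_of_eq ?_)
    congr 1; push_cast; ring
  rw [norm_mul, hw, Complex.norm_real, Real.norm_of_nonneg (by linarith [hs.2])] at h2
  linarith

theorem four_mul_abs_le_norm_one_sub_toCircle {t : ℝ} (ht : t ∈ Ioc (-(1 / 2) : ℝ) (1 / 2)) :
    4 * |t| ≤ ‖1 - (AddCircle.toCircle (t : UnitAddCircle) : ℂ)‖ := by
  have h := Real.mul_abs_le_abs_sin (x := Real.pi * t) (by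
    rw [abs_mul, abs_of_pos Real.pi_pos]
    have : |t| ≤ 1 / 2 := abs_le.2 ⟨ht.1.le, ht.2⟩
    nlinarith [Real.pi_pos])
  rw [norm_sub_rev, AddCircle.toCircle_apply_mk, Circle.coe_exp, mul_comm _ Complex.I,
    Complex.norm_exp_I_mul_ofReal_sub_one, norm_mul, Real.norm_eq_abs, Real.norm_eq_abs,
    show 2 * Real.pi / 1 * t / 2 = Real.pi * t by ring]
  rw [abs_mul, abs_of_pos Real.pi_pos, ← mul_assoc, div_mul_cancel₀ _ Real.pi_ne_zero] at h
  rw [abs_two]; linarith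

theorem norm_inv_one_sub_mul_toCircle_le {s M t : ℝ} (hs : s ∈ Ico (0 : ℝ) 1)
    (hM : 1 / (1 - s) ≤ M) (ht : t ∈ Ioc (-(1 / 2) : ℝ) (1 / 2)) (ht0 : t ≠ 0) :
    ‖(1 - s * (AddCircle.toCircle (t : UnitAddCircle) : ℂ))⁻¹‖ ≤ min M (1 / |t|) := by
  have hw : ‖(AddCircle.toCircle (t : UnitAddCircle) : ℂ)‖ = 1 := Circle.norm_coe _
  rw [norm_inv, ← one_div]
  refine le_min (le_trans ?_ hM) ?_
  · refine one_div_le_one_div_of_le (by linarith [hs.2]) ?_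
    have := norm_sub_norm_le (1 : ℂ) (s * (AddCircle.toCircle (t : UnitAddCircle) : ℂ))
    simpa [hw, abs_of_nonneg hs.1] using this
  · refine one_div_le_one_div_of_le (abs_pos.2 ht0) ?_
    have h1 := norm_one_sub_le_two_mul ⟨hs.1, hs.2.le⟩ hw
    have h2 := four_mul_abs_le_norm_one_sub_toCircle ht
    linarith [abs_nonneg t]

/-! ### Summation over dyadic scales -/

/-- With truncated subtraction one of the two terms of the exponent always vanishes: it is the
distance to `m` on the left and to `m + 1` on the right. Two geometric series result. -/
theorem sum_pow_tsub_add_tsub_le {ρ : ℝ} (h0 : 0 ≤ ρ) (h1 : ρ < 1) (N m : ℕ) :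
    ∑ k ∈ Finset.range N, ρ ^ ((m - k) + (k - (m + 1))) ≤ 2 * (1 - ρ)⁻¹ := by
  have hg : ∀ n, ∑ k ∈ Finset.range n, ρ ^ k ≤ (1 - ρ)⁻¹ := fun n =>
    ((summable_geometric_of_lt_one h0 h1).sum_le_tsum _ fun _ _ => by positivity).trans_eq
      (tsum_geometric_of_lt_one h0 h1)
  calc _ ≤ ∑ k ∈ Finset.range (m + 1 + N), ρ ^ ((m - k) + (k - (m + 1))) :=
        Finset.sum_le_sum_of_subset_of_nonneg
          (Finset.range_subset_range.2 (by omega)) fun _ _ _ => by positivity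
    _ = ∑ k ∈ Finset.range (m + 1), ρ ^ k + ∑ k ∈ Finset.range N, ρ ^ k := by
        rw [Finset.sum_range_add, ← Finset.sum_range_reflect _ (m + 1)]
        congr 1
        · refine Finset.sum_congr rfl fun k hk => ?_
          have := Finset.mem_range.1 hk
          congr 1; omega
        · refine Finset.sum_congr rfl fun k _ => ?_
          congr 1; omega
    _ ≤ _ := by linarith [hg (m + 1), hg N]

/-- The terms grow like `2^{k/p}` while `2^k ≤ 1/x` and then decay like `2^{-k/q}`, so the sum is
comparable to its peak `x^{-1/p}`. Since `p > 2` gives `1/p ≤ 1/q`, the ratio `2^{-1/p}` serves on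
both sides. -/
theorem sum_two_rpow_mul_min_le {p q : ℝ} (hp : 2 < p) (hpq : p.HolderConjugate q) {x : ℝ}
    (hx : 0 < x) (hx1 : x ≤ 1) (N : ℕ) :
    ∑ k ∈ Finset.range N, (2 : ℝ) ^ (-(k / q)) * min (2 ^ k) (1 / x) ≤
      2 * (1 - (2 : ℝ) ^ (-(1 / p)))⁻¹ * x ^ (-(1 / p)) := by
  have hp0 : 0 < p := by linarith
  have hq0 : 0 < q := hpq.symm.pos
  have hpq' : 1 / p + 1 / q = 1 := by simpa using hpq.inv_add_inv_eq_one
  have hpq2 : 1 / p ≤ 1 / q := by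
    have : 1 / p ≤ 1 / 2 := one_div_le_one_div_of_le (by norm_num) hp.le
    linarith
  have h2 : (0 : ℝ) < 2 := by norm_num
  have hρ : (2 : ℝ) ^ (-(1 / p)) < 1 :=
    Real.rpow_lt_one_of_one_lt_of_neg (by norm_num) (by simpa using hp0)
  obtain ⟨m, hm1, hm2⟩ := exists_nat_pow_near (x := 1 / x) (y := (2 : ℝ))
    (by rw [le_div_iff₀ hx]; linarith) (by norm_num)
  have hy : 0 < 1 / x := by positivity
  have key : ∀ k : ℕ, (2 : ℝ) ^ (-(k / q)) * min (2 ^ k) (1 / x) ≤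
      ((2 : ℝ) ^ (-(1 / p))) ^ ((m - k) + (k - (m + 1))) * x ^ (-(1 / p)) := by
    intro k
    have hxp : x ^ (-(1 / p)) = (1 / x) ^ (1 / p) := by
      rw [one_div x, Real.inv_rpow hx.le, Real.rpow_neg hx.le]
    rw [hxp]
    rcases le_or_gt k m with hk | hk
    · rw [show (m - k) + (k - (m + 1)) = m - k by omega, ← Real.rpow_natCast (2 ^ _),
        ← Real.rpow_mul h2.le, Nat.cast_sub hk]
      calc (2 : ℝ) ^ (-(k / q)) * min (2 ^ k) (1 / x) ≤ (2 : ℝ) ^ (-(k / q)) * 2 ^ k := by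
            gcongr; exact min_le_left _ _
        _ = (2 : ℝ) ^ (-(1 / p) * ((m : ℝ) - k)) * ((2 : ℝ) ^ m) ^ (1 / p) := by
            rw [← Real.rpow_natCast, ← Real.rpow_natCast 2 m, ← Real.rpow_mul h2.le,
              ← Real.rpow_add h2, ← Real.rpow_add h2]
            congr 1
            rw [show 1 / p = 1 - 1 / q by linarith]; ring
        _ ≤ _ := by gcongr
    · rw [show (m - k) + (k - (m + 1)) = k - (m + 1) by omega, ← Real.rpow_natCast (2 ^ _),
        ← Real.rpow_mul h2.le, Nat.cast_sub hk]
      have hk' : ((m : ℝ) + 1) ≤ k := by exact_mod_cast hk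
      calc (2 : ℝ) ^ (-(k / q)) * min (2 ^ k) (1 / x) ≤ (2 : ℝ) ^ (-(k / q)) * (1 / x) := by
            gcongr; exact min_le_right _ _
        _ = (2 : ℝ) ^ (-(k / q)) * (1 / x) ^ (1 / q) * (1 / x) ^ (1 / p) := by
            rw [mul_assoc, ← Real.rpow_add hy, add_comm, hpq', Real.rpow_one]
        _ ≤ (2 : ℝ) ^ (-(k / q)) * ((2 : ℝ) ^ (m + 1)) ^ (1 / q) * (1 / x) ^ (1 / p) := by
            gcongr
        _ = (2 : ℝ) ^ (-(1 / q) * ((k : ℝ) - (m + 1))) * (1 / x) ^ (1 / p) := by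
            rw [← Real.rpow_natCast, ← Real.rpow_mul h2.le, ← Real.rpow_add h2]
            push_cast
            congr 2; ring
        _ ≤ _ := by
            push_cast
            gcongr
            · norm_num
  calc _ ≤ ∑ k ∈ Finset.range N,
        ((2 : ℝ) ^ (-(1 / p))) ^ ((m - k) + (k - (m + 1))) * x ^ (-(1 / p)) :=
        Finset.sum_le_sum fun k _ => key k
    _ ≤ _ := by
        rw [← Finset.sum_mul]
        gcongr
        exact sum_pow_tsub_add_tsub_le (by positivity) hρ N m

theorem eLpNorm_dilate_eq {p : ℝ} (hp : 0 < p) (f : ℂ → ℂ) (r : ℝ) :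
    eLpNorm (fun t : UnitAddCircle => f ((r : ℂ) * (AddCircle.toCircle t : ℂ)))
      (ENNReal.ofReal p) AddCircle.haarAddCircle =
    (∫⁻ t : UnitAddCircle, ‖f ((r : ℂ) * (AddCircle.toCircle t : ℂ))‖ₑ ^ p
      ∂AddCircle.haarAddCircle) ^ (1 / p) := by
  rw [eLpNorm_eq_lintegral_rpow_enorm_toReal (by simpa using hp) ENNReal.ofReal_ne_top,
    ENNReal.toReal_ofReal hp.le]

theorem circleAverage_eq_integral_haarAddCircle (g : ℂ → ℂ) (R : ℝ) :
    Real.circleAverage g 0 R =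
      ∫ t : UnitAddCircle, g ((R : ℂ) * (AddCircle.toCircle t : ℂ)) ∂AddCircle.haarAddCircle := by
  have hv : (AddCircle.haarAddCircle : Measure UnitAddCircle) = volume := by
    rw [AddCircle.volume_eq_smul_haarAddCircle]; simp
  rw [hv, ← UnitAddCircle.intervalIntegral_preimage 0, Real.circleAverage_def]
  have h := intervalIntegral.integral_comp_mul_left (a := 0) (b := 1)
    (fun θ => g (circleMap 0 R θ)) (c := 2 * Real.pi) (by positivity)
  rw [mul_zero, mul_one] at h
  rw [← h, zero_add]
  refine intervalIntegral.integral_congr fun t _ => ?_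
  simp only [AddCircle.toCircle_apply_mk, circleMap, Circle.coe_exp, zero_add, div_one]

/-! ### Point evaluation at the dyadic radii -/

/-- The radii `1 - 2^{-k}`. -/
noncomputable def dyadicRadius (k : ℕ) : ℝ := 1 - 1 / 2 ^ k

theorem dyadicRadius_mem (k : ℕ) : dyadicRadius k ∈ Ico (0 : ℝ) 1 := by
  have h : (1 : ℝ) ≤ 2 ^ k := one_le_pow₀ (by norm_num)
  have h1 : 1 / (2 : ℝ) ^ k ≤ 1 := by rw [div_le_one (by positivity)]; exact h
  have h2 : 0 < 1 / (2 : ℝ) ^ k := by positivity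
  exact ⟨by unfold dyadicRadius; linarith, by unfold dyadicRadius; linarith⟩

theorem coe_dyadicRadius_mem_ball (k : ℕ) : (dyadicRadius k : ℂ) ∈ ball (0 : ℂ) 1 := by
  have h := dyadicRadius_mem k
  simp [abs_of_nonneg h.1, h.2]

/-- On the unit circle `|w - σ| = |1 - σ w̄|`, and conjugation is harmless as `σ` is real. It turns
the Cauchy kernel into the Szegő form. -/
theorem norm_sub_ofReal_eq {w : ℂ} (hw : ‖w‖ = 1) (σ : ℝ) : ‖w - σ‖ = ‖1 - σ * w‖ := by
  have h : w.re * w.re + w.im * w.im = 1 := by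
    rw [← Complex.normSq_apply, Complex.normSq_eq_norm_sq, hw, one_pow]
  rw [Complex.norm_def, Complex.norm_def]
  congr 1
  simp only [Complex.normSq_apply, Complex.sub_re, Complex.sub_im, Complex.ofReal_re,
    Complex.ofReal_im, Complex.one_re, Complex.one_im, Complex.mul_re, Complex.mul_im]
  linear_combination (1 - σ ^ 2) * h

/-- Cauchy's formula and Hölder: the kernel has `L^q` norm of order `(2^k)^{(q-1)/q} = 2^{k/p}`. -/
theorem enorm_apply_dyadicRadius_le {p q : ℝ} (hp : 2 < p) (hpq : p.HolderConjugate q) :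
    ∃ K : ℝ≥0, ∀ f : ℂ → ℂ, DifferentiableOn ℂ f (ball 0 1) → ∀ k,
      ‖f (dyadicRadius k)‖ₑ ≤
        K * ENNReal.ofReal (((2 : ℝ) ^ k) ^ (1 / p)) * hardyENorm (ENNReal.ofReal p) f := by
  have hp0 : 0 < p := by linarith
  have hq0 : 0 < q := hpq.symm.pos
  have hq1 : 1 < q := hpq.symm.lt
  have hpq' : 1 / p + 1 / q = 1 := by simpa using hpq.inv_add_inv_eq_one
  refine ⟨(2 * (2 ^ (q - 1) * (1 + 1 / (q - 1)))).toNNReal ^ (1 / q), fun f hf k => ?_⟩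
  obtain ⟨hs0, hs1⟩ := dyadicRadius_mem k
  have hk : 1 - dyadicRadius k = 1 / 2 ^ k := by unfold dyadicRadius; ring
  set s := dyadicRadius k
  -- Cauchy's formula needs a circle inside the open disk. The midpoint radius costs only a factor
  -- `2`: `1 - s/ρ` is still at least `2^{-k}/2`.
  set ρ : ℝ := (1 + s) / 2 with hρ
  have hρ0 : 0 < ρ := by rw [hρ]; linarith
  have hρ1 : ρ < 1 := by rw [hρ]; linarith
  have hsρ : s < ρ := by rw [hρ]; linarith
  have hσ : s / ρ ∈ Ico (0 : ℝ) 1 := ⟨by positivity, (div_lt_one hρ0).2 hsρ⟩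
  have hM : 1 / (1 - s / ρ) ≤ 2 * 2 ^ k := by
    have h1 : (0 : ℝ) < 2 ^ k := by positivity
    rw [div_le_iff₀ (by linarith [hσ.2]),
      show 1 - s / ρ = (1 / 2 ^ k) / (2 * ρ) by rw [← hk, hρ]; field_simp; ring]
    field_simp
    exact hρ1.le
  have hc := DiffContOnCl.circleAverage_smul_div (f := f) (c := 0) (R := ρ) (w := s)
    (by
      rw [abs_of_pos hρ0]
      refine (hf.mono ?_).diffContOnCl
      rw [closure_ball _ hρ0.ne']
      exact closedBall_subset_ball hρ1)
    (by simpa [abs_of_pos hρ0, abs_of_nonneg hs0] using hsρ)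
  rw [circleAverage_eq_integral_haarAddCircle] at hc
  have hcont := hardy_dilate_continuous hf ⟨hρ0, hρ1⟩
  have hcirc := AddCircle.continuous_toCircle (T := (1 : ℝ))
  have hne : ∀ t : UnitAddCircle, 1 - ((s / ρ : ℝ) : ℂ) * (AddCircle.toCircle t : ℂ) ≠ 0 := by
    intro t h
    have h1 := congrArg norm (sub_eq_zero.1 h)
    rw [norm_mul, Circle.norm_coe, Complex.norm_real, Real.norm_of_nonneg hσ.1, norm_one] at h1
    linarith [hσ.2]
  have hcont' : Continuous fun t : UnitAddCircle =>
      (1 - ((s / ρ : ℝ) : ℂ) * (AddCircle.toCircle t : ℂ))⁻¹ :=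
    Continuous.inv₀ (by fun_prop) hne
  have hint : ∫⁻ t : UnitAddCircle,
      ‖(1 - ((s / ρ : ℝ) : ℂ) * (AddCircle.toCircle t : ℂ))⁻¹‖ₑ ^ q ∂AddCircle.haarAddCircle ≤
        ENNReal.ofReal (2 * (2 ^ (q - 1) * (1 + 1 / (q - 1))) * (2 ^ k) ^ (q - 1)) := by
    refine (lintegral_haarAddCircle_le
      (F := fun x => ENNReal.ofReal (min (2 * 2 ^ k) (1 / x) ^ q * x ^ (-(0 : ℝ))))
      fun t ht ht0 => ?_).trans ?_
    · rw [neg_zero, Real.rpow_zero, mul_one, ← ofReal_norm,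
        ENNReal.ofReal_rpow_of_nonneg (norm_nonneg _) hq0.le]
      gcongr
      exact norm_inv_one_sub_mul_toCircle_le hσ hM ht ht0
    · refine (mul_le_mul_right (lintegral_Ioi_min_rpow_le (by positivity) (by norm_num)
        (by linarith)) 2).trans_eq ?_
      rw [← ENNReal.ofReal_ofNat 2, ← ENNReal.ofReal_mul (by norm_num)]
      congr 1
      rw [Real.mul_rpow (by norm_num) (by positivity)]
      simp only [add_zero, sub_zero, div_one]
      ring
  rw [← hc]
  refine (enorm_integral_le_lintegral_enorm _).trans ?_
  calc _ = ∫⁻ t : UnitAddCircle, ((fun t : UnitAddCircle => ‖f ((ρ : ℂ) * (AddCircle.toCircle t : ℂ))‖ₑ) *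
        (fun t : UnitAddCircle => ‖(1 - ((s / ρ : ℝ) : ℂ) * (AddCircle.toCircle t : ℂ))⁻¹‖ₑ)) t
          ∂AddCircle.haarAddCircle := by
        refine lintegral_congr fun t => ?_
        simp only [Pi.mul_apply, sub_zero]
        rw [enorm_smul, mul_comm]
        congr 1
        rw [← ofReal_norm, ← ofReal_norm]
        congr 1
        have hρc : (ρ : ℂ) ≠ 0 := by exact_mod_cast hρ0.ne'
        have e : (ρ : ℂ) * (AddCircle.toCircle t : ℂ) - s =
            ρ * ((AddCircle.toCircle t : ℂ) - (s / ρ : ℝ)) := by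
          push_cast; field_simp
        have e2 := norm_sub_ofReal_eq (Circle.norm_coe (AddCircle.toCircle t)) (s / ρ)
        rw [e, norm_div, norm_inv, norm_mul, norm_mul, e2, Circle.norm_coe, mul_one, div_mul_eq_div_div,
          div_self (norm_ne_zero_iff.2 hρc), one_div]
    _ ≤ _ := ENNReal.lintegral_mul_le_Lp_mul_Lq _ hpq hcont.enorm.aemeasurable
          hcont'.enorm.aemeasurable
    _ ≤ hardyENorm (ENNReal.ofReal p) f *
        ENNReal.ofReal (2 * (2 ^ (q - 1) * (1 + 1 / (q - 1))) * (2 ^ k) ^ (q - 1)) ^ (1 / q) := by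
        gcongr
        rw [← eLpNorm_dilate_eq hp0]
        exact le_iSup₂ (f := fun (r : ℝ) (_ : r ∈ Ioo (0 : ℝ) 1) => eLpNorm
            (fun t : UnitAddCircle => f ((r : ℂ) * (AddCircle.toCircle t : ℂ)))
            (ENNReal.ofReal p) AddCircle.haarAddCircle) ρ ⟨hρ0, hρ1⟩
    _ = _ := by
        rw [mul_comm]
        congr 1
        have h1 : 0 ≤ 1 / (q - 1) := one_div_nonneg.2 (by linarith)
        have h2 : (0 : ℝ) ≤ 1 / q := by positivity
        rw [ENNReal.ofReal_mul (by positivity), ENNReal.mul_rpow_of_nonneg _ _ h2,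
          ENNReal.coe_rpow_of_nonneg _ h2,
          ENNReal.ofReal_rpow_of_nonneg (x := (2 ^ k) ^ (q - 1)) (by positivity) h2, ← Real.rpow_mul (by positivity)]
        congr 3
        field_simp
        field_simp at hpq'
        linarith

/-! ### Szegő kernels and their upper `ℓ^p` estimate -/

/-- The Szegő kernels at the dyadic radii, normalized to have `H^p` norm of order one for the
exponent `p` conjugate to `q`. -/
noncomputable def szegoKernel (q : ℝ) (k : ℕ) : ℂ → ℂ :=
  (ball 0 1).indicator fun z =>
    (((2 : ℝ) ^ (-(k / q) : ℝ) : ℝ) : ℂ) * (1 - dyadicRadius k * z)⁻¹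

theorem szegoKernel_of_notMem (q : ℝ) (k : ℕ) {z : ℂ} (hz : z ∉ ball (0 : ℂ) 1) :
    szegoKernel q k z = 0 :=
  indicator_of_notMem hz _

theorem szegoKernel_differentiableOn (q : ℝ) (k : ℕ) :
    DifferentiableOn ℂ (szegoKernel q k) (ball 0 1) := by
  refine DifferentiableOn.congr (f := fun z : ℂ =>
    (((2 : ℝ) ^ (-(k / q) : ℝ) : ℝ) : ℂ) * (1 - dyadicRadius k * z)⁻¹) ?_
    fun z hz => indicator_of_mem hz _
  refine DifferentiableOn.const_mul (DifferentiableOn.inv (by fun_prop) fun z hz h => ?_) _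
  have h1 := congrArg norm (sub_eq_zero.1 h)
  obtain ⟨h2, h3⟩ := dyadicRadius_mem k
  rw [norm_mul, Complex.norm_real, Real.norm_of_nonneg h2, norm_one] at h1
  have : ‖z‖ < 1 := by simpa using hz
  nlinarith [norm_nonneg z]

/-- `1 - s_k² ≤ 2 (1 - s_k) = 2 · 2^{-k}`, and `k - k/q = k/p`: up to a constant the kernel attains
the growth bound at its own radius. -/
theorem szegoKernel_apply_dyadicRadius {p q : ℝ} (hpq : p.HolderConjugate q) (k : ℕ) :
    ENNReal.ofReal (1 / 2 * ((2 : ℝ) ^ k) ^ (1 / p)) ≤ ‖szegoKernel q k (dyadicRadius k)‖ₑ := by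
  have hpq' : 1 / p + 1 / q = 1 := by simpa using hpq.inv_add_inv_eq_one
  rw [szegoKernel, indicator_of_mem (coe_dyadicRadius_mem_ball k), ← ofReal_norm]
  gcongr
  obtain ⟨h2, h3⟩ := dyadicRadius_mem k
  have hk : 1 - dyadicRadius k = 1 / 2 ^ k := by unfold dyadicRadius; ring
  have hpos : 0 < 1 - dyadicRadius k * dyadicRadius k := by nlinarith
  have hle : 1 - dyadicRadius k * dyadicRadius k ≤ 2 * (1 / 2 ^ k) := by rw [← hk]; nlinarith
  rw [norm_mul, Complex.norm_real, Real.norm_of_nonneg (by positivity), norm_inv,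
    ← Complex.ofReal_mul, ← Complex.ofReal_one, ← Complex.ofReal_sub, Complex.norm_real,
    Real.norm_of_nonneg hpos.le]
  calc 1 / 2 * ((2 : ℝ) ^ k) ^ (1 / p) = (2 : ℝ) ^ (-(k / q) : ℝ) * (2 * (1 / 2 ^ k))⁻¹ := by
        have e : (2 * (1 / (2 : ℝ) ^ k))⁻¹ = 1 / 2 * 2 ^ k := by field_simp
        rw [e, ← Real.rpow_natCast, ← Real.rpow_mul (by norm_num), mul_left_comm,
          ← Real.rpow_add (by norm_num)]
        congr 2
        rw [show 1 / p = 1 - 1 / q by linarith]; ring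
    _ ≤ _ := by gcongr

/-- The majorant does not depend on `r`, so the supremum in the Hardy norm costs nothing. -/
theorem enorm_szegoKernel_le {q r t : ℝ} (k : ℕ) (hr : r ∈ Ioo (0 : ℝ) 1)
    (ht : t ∈ Ioc (-(1 / 2) : ℝ) (1 / 2)) (ht0 : t ≠ 0) :
    ‖szegoKernel q k ((r : ℂ) * (AddCircle.toCircle (t : UnitAddCircle) : ℂ))‖ₑ ≤
      ENNReal.ofReal ((2 : ℝ) ^ (-(k / q) : ℝ) * min (2 ^ k) (1 / |t|)) := by
  have hmem : (r : ℂ) * (AddCircle.toCircle (t : UnitAddCircle) : ℂ) ∈ ball (0 : ℂ) 1 := by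
    have h1 : ‖(AddCircle.toCircle (t : UnitAddCircle) : ℂ)‖ = 1 := Circle.norm_coe _
    simp [h1, abs_of_pos hr.1, hr.2]
  obtain ⟨h2, h3⟩ := dyadicRadius_mem k
  have hk : 1 - dyadicRadius k = 1 / 2 ^ k := by unfold dyadicRadius; ring
  have hlt : dyadicRadius k * r < 1 := by nlinarith [hr.1, hr.2]
  rw [szegoKernel, indicator_of_mem hmem, ← ofReal_norm, norm_mul, Complex.norm_real,
    Real.norm_of_nonneg (by positivity), ← mul_assoc, ← Complex.ofReal_mul]
  gcongr
  refine norm_inv_one_sub_mul_toCircle_le ⟨mul_nonneg h2 hr.1.le, hlt⟩ ?_ ht ht0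
  rw [div_le_iff₀ (by linarith)]
  have h4 : 1 / (2 : ℝ) ^ k ≤ 1 - dyadicRadius k * r := by rw [← hk]; nlinarith [hr.1, hr.2]
  calc (1 : ℝ) = 2 ^ k * (1 / 2 ^ k) := by field_simp
    _ ≤ _ := by gcongr

theorem sum_mul_rpow_le {ι : Type*} (s : Finset ι) {p q : ℝ} (hpq : p.HolderConjugate q)
    (w f : ι → ℝ≥0∞) :
    (∑ i ∈ s, w i * f i) ^ p ≤ (∑ i ∈ s, w i * f i ^ p) * (∑ i ∈ s, w i) ^ (p / q) := by
  have hp := hpq.pos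
  have h := ENNReal.rpow_le_rpow (ENNReal.inner_le_weight_mul_Lp_of_nonneg s hpq.lt.le w f) hp.le
  rw [ENNReal.mul_rpow_of_nonneg _ _ hp.le, ← ENNReal.rpow_mul, ← ENNReal.rpow_mul,
    inv_mul_cancel₀ hp.ne', ENNReal.rpow_one, mul_comm, hpq.one_sub_inv, inv_mul_eq_div] at h
  exact h

/-- A Schur test. With `G_k` the majorant of the `k`-th kernel, weighted Hölder gives `(∑ G_k
|c_k|)^p ≤ (∑ G_k |c_k|^p) (∑ G_k)^{p/q}`. The last factor is at most a constant times `x^{-1/q}`,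
and `∫ G_k x^{-1/q}` is bounded uniformly in `k`. -/
theorem hardyENorm_sum_szegoKernel_le {p q : ℝ} (hp : 2 < p) (hpq : p.HolderConjugate q) :
    ∃ K : ℝ≥0, ∀ (N : ℕ) (c : ℕ → ℂ),
      hardyENorm (ENNReal.ofReal p) (∑ k ∈ Finset.range N, c k • szegoKernel q k) ≤
        K * (∑ k ∈ Finset.range N, ‖c k‖ₑ ^ p) ^ (1 / p) := by
  have hp0 : 0 < p := by linarith
  have hq0 : 0 < q := hpq.symm.pos
  have hq1 : 1 < q := hpq.symm.lt
  have hpq' : 1 / p + 1 / q = 1 := by simpa using hpq.inv_add_inv_eq_one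
  set A : ℝ := 2 * (1 - (2 : ℝ) ^ (-(1 / p)))⁻¹ with hA
  have hρ : (2 : ℝ) ^ (-(1 / p)) < 1 :=
    Real.rpow_lt_one_of_one_lt_of_neg (by norm_num) (by simpa using hp0)
  have hA0 : 0 ≤ A := by
    have : 0 ≤ (1 - (2 : ℝ) ^ (-(1 / p)))⁻¹ := inv_nonneg.2 (by linarith)
    positivity
  have hqi : 1 / q < 1 := by rw [div_lt_one hq0]; exact hq1
  set B : ℝ := 1 / (1 - 1 / q) + 1 / (1 + 1 / q - 1) with hB
  have hB0 : 0 ≤ B :=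
    add_nonneg (one_div_nonneg.2 (by linarith)) (one_div_nonneg.2 (by
      have : 0 < 1 / q := by positivity
      linarith))
  -- The `2` comes from folding the circle, `A` from the pointwise bound on `∑ G_k`, and `B` from
  -- the half-line integral with `a = 1`, `b = 1/q`.
  refine ⟨(2 * (A ^ (p / q) * B)).toNNReal ^ (1 / p), fun N c => iSup₂_le fun r hr => ?_⟩
  rw [eLpNorm_dilate_eq hp0, ENNReal.coe_rpow_of_nonneg _ (by positivity),
    ← ENNReal.mul_rpow_of_nonneg _ _ (by positivity)]
  gcongr
  set G : ℕ → ℝ → ℝ≥0∞ := fun k x =>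
    ENNReal.ofReal ((2 : ℝ) ^ (-(k / q) : ℝ) * min (2 ^ k) (1 / x)) with hG
  have hmeas : ∀ k, Measurable fun x : ℝ => ‖c k‖ₑ ^ p *
      (G k x * ENNReal.ofReal (A * x ^ (-(1 / p))) ^ (p / q)) := by
    intro k; simp only [hG]; fun_prop
  have hGint : ∀ k, ∫⁻ x in Ioi (0 : ℝ), G k x * ENNReal.ofReal (A * x ^ (-(1 / p))) ^ (p / q) ≤
      ENNReal.ofReal (A ^ (p / q) * B) := by
    intro k
    calc _ = ∫⁻ x in Ioi (0 : ℝ), ENNReal.ofReal ((2 : ℝ) ^ (-(k / q) : ℝ) * A ^ (p / q)) *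
          ENNReal.ofReal (min (2 ^ k) (1 / x) ^ (1 : ℝ) * x ^ (-(1 / q))) := by
          refine setLIntegral_congr_fun measurableSet_Ioi fun x hx => ?_
          have hx0 : 0 < x := hx
          simp only [hG]
          rw [ENNReal.ofReal_rpow_of_nonneg (by positivity) (by positivity),
            ← ENNReal.ofReal_mul (by positivity), ← ENNReal.ofReal_mul (by positivity),
            Real.mul_rpow hA0 (by positivity), ← Real.rpow_mul hx0.le, Real.rpow_one]
          congr 1
          rw [show -(1 / p) * (p / q) = -(1 / q) by field_simp]
          ring
      _ ≤ ENNReal.ofReal ((2 : ℝ) ^ (-(k / q) : ℝ) * A ^ (p / q)) *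
          ENNReal.ofReal ((2 ^ k) ^ (1 + 1 / q - 1) * B) := by
          rw [lintegral_const_mul' _ _ ENNReal.ofReal_ne_top]
          gcongr
          exact lintegral_Ioi_min_rpow_le (by positivity) hqi (by
            have : 0 < 1 / q := by positivity
            linarith)
      _ = _ := by
          rw [← ENNReal.ofReal_mul (by positivity)]
          congr 1
          -- The normalization `2^{-k/q}` exactly cancels the growth of the integral, which makes
          -- the bound independent of `k`.
          have e : (2 : ℝ) ^ (-(k / q) : ℝ) * (2 ^ k) ^ (1 + 1 / q - 1) = 1 := by
            rw [← Real.rpow_natCast, ← Real.rpow_mul (by norm_num), ← Real.rpow_add (by norm_num)]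
            convert Real.rpow_zero (2 : ℝ) using 2
            ring
          linear_combination (A ^ (p / q) * B) * e
  refine (lintegral_haarAddCircle_le (F := fun x => ∑ k ∈ Finset.range N, ‖c k‖ₑ ^ p *
      (G k x * ENNReal.ofReal (A * x ^ (-(1 / p))) ^ (p / q))) fun t ht ht0 => ?_).trans ?_
  · have hGt : ∑ k ∈ Finset.range N, G k |t| ≤ ENNReal.ofReal (A * |t| ^ (-(1 / p))) := by
      have ht1 : |t| ≤ 1 := by rw [abs_le]; constructor <;> linarith [ht.1, ht.2]
      simp only [hG]
      rw [← ENNReal.ofReal_sum_of_nonneg fun k _ => by positivity]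
      exact ENNReal.ofReal_le_ofReal (sum_two_rpow_mul_min_le hp hpq (abs_pos.2 ht0) ht1 N)
    calc _ ≤ (∑ k ∈ Finset.range N, G k |t| * ‖c k‖ₑ) ^ p := by
          gcongr
          rw [Finset.sum_apply]
          refine (enorm_sum_le _ _).trans (Finset.sum_le_sum fun k _ => ?_)
          rw [Pi.smul_apply, enorm_smul, mul_comm]
          gcongr
          exact enorm_szegoKernel_le k hr ht ht0
      _ ≤ (∑ k ∈ Finset.range N, G k |t| * ‖c k‖ₑ ^ p) *
          (∑ k ∈ Finset.range N, G k |t|) ^ (p / q) := sum_mul_rpow_le _ hpq _ _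
      _ ≤ (∑ k ∈ Finset.range N, G k |t| * ‖c k‖ₑ ^ p) *
          ENNReal.ofReal (A * |t| ^ (-(1 / p))) ^ (p / q) := by gcongr
      _ = _ := by
          rw [Finset.sum_mul]
          exact Finset.sum_congr rfl fun k _ => by ring
  · rw [lintegral_finsetSum _ fun k _ => hmeas k]
    calc _ ≤ 2 * ∑ k ∈ Finset.range N, ‖c k‖ₑ ^ p * ENNReal.ofReal (A ^ (p / q) * B) := by
          gcongr with k
          rw [lintegral_const_mul' _ _ (by finiteness)]
          gcongr
          exact hGint k
      _ = _ := by
          rw [← Finset.sum_mul, mul_comm (∑ k ∈ Finset.range N, ‖c k‖ₑ ^ p), ← mul_assoc]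
          congr 1
          rw [← ENNReal.ofReal_ofNat 2, ← ENNReal.ofReal_mul (by norm_num)]
          rfl

/-! ### The measure and its Luecking boxes -/

/-- The discrete measure `∑ (n + 1)^{-s} 2^{-n} δ_{1 - 2^{-n}}`. -/
noncomputable def dyadicMeasure (s : ℝ) : Measure ℂ :=
  Measure.sum fun n : ℕ => ENNReal.ofReal (((n : ℝ) + 1) ^ (-s) / 2 ^ n) •
    Measure.dirac (dyadicRadius n : ℂ)

theorem tsum_ofReal_rpow_neg_lt_top {s : ℝ} (hs : 1 < s) :
    ∑' n : ℕ, ENNReal.ofReal (((n : ℝ) + 1) ^ (-s)) < ∞ := by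
  have h := (summable_nat_add_iff 1).2 (Real.summable_nat_rpow.2 (by linarith : -s < -1))
  push_cast at h
  exact h.tsum_ofReal_lt_top

theorem lintegral_dyadicMeasure (s : ℝ) (F : ℂ → ℝ≥0∞) :
    ∫⁻ z, F z ∂dyadicMeasure s =
      ∑' n : ℕ, ENNReal.ofReal (((n : ℝ) + 1) ^ (-s) / 2 ^ n) * F (dyadicRadius n) := by
  simp [dyadicMeasure, lintegral_sum_measure, lintegral_smul_measure]

theorem isFiniteMeasure_dyadicMeasure {s : ℝ} (hs : 1 < s) :
    IsFiniteMeasure (dyadicMeasure s) := by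
  refine ⟨?_⟩
  rw [← lintegral_one, lintegral_dyadicMeasure]
  refine (ENNReal.tsum_le_tsum fun n => ?_).trans_lt (tsum_ofReal_rpow_neg_lt_top hs)
  rw [mul_one]
  exact ENNReal.ofReal_le_ofReal (div_le_self (by positivity) (one_le_pow₀ (by norm_num)))

theorem dyadicMeasure_compl_segment (s : ℝ) :
    dyadicMeasure s ((fun t : ℝ => (t : ℂ)) '' Ico (0 : ℝ) 1)ᶜ = 0 := by
  refine Measure.sum_apply_eq_zero.2 fun n => ?_
  have h : (dyadicRadius n : ℂ) ∈ (fun t : ℝ => (t : ℂ)) '' Ico (0 : ℝ) 1 :=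
    ⟨_, dyadicRadius_mem n, rfl⟩
  rw [Measure.smul_apply, Measure.dirac_apply, indicator_of_notMem (notMem_compl_iff.2 h), smul_zero]

/-- Positive reals have argument `2π` in the convention `(0, 2π]`, so they lie only in the last
sector. The hypothesis forces `n ≥ 1`, so the annulus avoids the origin. -/
theorem dyadicMeasure_lueckingBox_eq_zero (s : ℝ) {n j : ℕ} (hj : j + 1 < 2 ^ n) :
    dyadicMeasure s (lueckingBox n j) = 0 := by
  refine measure_mono_null ?_ (dyadicMeasure_compl_segment s)
  rintro z ⟨h1, h2, θ, ⟨hθ1, hθ2⟩, hz⟩ ⟨t, ht, rfl⟩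
  have hn : n ≠ 0 := by rintro rfl; simp at hj
  have h3 : 1 / (2 : ℝ) ^ n < 1 := by
    rw [div_lt_one (by positivity)]; exact one_lt_pow₀ (by norm_num) hn
  have ht0 : 0 < t := by
    simp only [Complex.norm_real, Real.norm_of_nonneg ht.1] at h1
    linarith
  have hθ0 : 0 < θ := lt_of_le_of_lt (by positivity) hθ1
  have hθ : θ < 2 * Real.pi := by
    refine hθ2.trans_lt ?_
    rw [div_lt_iff₀ (by positivity)]
    have : (j : ℝ) + 1 < 2 ^ n := by exact_mod_cast hj
    have := Real.pi_pos
    gcongr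
  have hz' := congrArg Complex.re hz
  simp only [Complex.norm_real, Real.norm_of_nonneg ht.1, Complex.ofReal_re, Complex.re_ofReal_mul,
    Complex.exp_ofReal_mul_I_re] at hz'
  have hcos : Real.cos θ = 1 := by
    have : t * (Real.cos θ - 1) = 0 := by linarith
    rcases mul_eq_zero.1 this with h | h <;> linarith
  exact hθ0.ne' ((Real.cos_eq_one_iff_of_lt_of_lt (by linarith) hθ).1 hcos)

/-- The annulus is closed on the inside and open on the outside, so its only atom is the one at `1 -
2^{-n}`. -/
theorem dyadicMeasure_lueckingBox_le (s : ℝ) (n j : ℕ) :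
    dyadicMeasure s (lueckingBox n j) ≤ ENNReal.ofReal (((n : ℝ) + 1) ^ (-s) / 2 ^ n) := by
  set S : Set ℂ := {z | 1 - 1 / (2 : ℝ) ^ n ≤ ‖z‖ ∧ ‖z‖ < 1 - 1 / (2 : ℝ) ^ (n + 1)} with hS
  have hSm : MeasurableSet S :=
    (measurableSet_le measurable_const measurable_norm).inter
      (measurableSet_lt measurable_norm measurable_const)
  refine (measure_mono (t := S) fun z hz => ⟨hz.1, hz.2.1⟩).trans ?_
  rw [← lintegral_indicator_one hSm, lintegral_dyadicMeasure, tsum_eq_single n]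
  · refine mul_le_of_le_one_right' ?_
    exact indicator_le_self' (fun _ _ => zero_le_one) _
  · intro m hm
    rw [indicator_of_notMem, mul_zero]
    rintro ⟨h1, h2⟩
    rw [Complex.norm_real, Real.norm_of_nonneg (dyadicRadius_mem m).1, dyadicRadius] at h1 h2
    have h3 : 1 / (2 : ℝ) ^ m ≤ 1 / 2 ^ n := by linarith
    have h4 : 1 / (2 : ℝ) ^ (n + 1) < 1 / 2 ^ m := by linarith
    rw [one_div_le_one_div (by positivity) (by positivity)] at h3
    rw [one_div_lt_one_div (by positivity) (by positivity)] at h4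
    have h5 := (pow_le_pow_iff_right₀ (by norm_num : (1 : ℝ) < 2)).1 h3
    have h6 := (pow_lt_pow_iff_right₀ (by norm_num : (1 : ℝ) < 2)).1 h4
    omega

theorem tsum_lueckingBox_lt_top {p q : ℝ} (hp : 2 < p) (hpq : p.HolderConjugate q) :
    (∑' n : ℕ, (∑ j ∈ Finset.range (2 ^ n),
      (2 ^ n * dyadicMeasure (p / q) (lueckingBox n j)) ^ (q / p)) ^ (2 / q)) ^ (1 / 2 : ℝ) < ∞ := by
  have hp0 : 0 < p := by linarith
  have hq0 : 0 < q := hpq.symm.pos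
  have hpq' : 1 / p + 1 / q = 1 := by simpa using hpq.inv_add_inv_eq_one
  have hq2 : 1 < 2 / q := by
    have : 1 / p < 1 / 2 := one_div_lt_one_div_of_lt (by norm_num) hp
    have e : 2 / q = 2 * (1 / q) := by ring
    rw [e]; linarith
  refine ENNReal.rpow_lt_top_of_nonneg (by norm_num)
    ((ENNReal.tsum_le_tsum fun n => ?_).trans_lt (tsum_ofReal_rpow_neg_lt_top hq2)).ne
  have hsum : ∑ j ∈ Finset.range (2 ^ n),
      (2 ^ n * dyadicMeasure (p / q) (lueckingBox n j)) ^ (q / p) ≤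
        ENNReal.ofReal (((n : ℝ) + 1) ^ (-(p / q))) ^ (q / p) := by
    -- The last index, whose sector contains the argument `2π`.
    have h1 : 2 ^ n - 1 ∈ Finset.range (2 ^ n) :=
      Finset.mem_range.2 (Nat.sub_lt (by positivity) one_pos)
    rw [Finset.sum_eq_single_of_mem _ h1]
    · gcongr
      refine (mul_le_mul_right (dyadicMeasure_lueckingBox_le _ _ _) _).trans_eq ?_
      rw [← ENNReal.ofReal_ofNat 2, ← ENNReal.ofReal_pow (by norm_num),
        ← ENNReal.ofReal_mul (by positivity)]
      congr 1
      field_simp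
    · intro j hj hjn
      have := Finset.mem_range.1 hj
      rw [dyadicMeasure_lueckingBox_eq_zero _ (by omega), mul_zero,
        ENNReal.zero_rpow_of_pos (by positivity)]
  calc _ ≤ (ENNReal.ofReal (((n : ℝ) + 1) ^ (-(p / q))) ^ (q / p)) ^ (2 / q) := by gcongr
    _ = _ := by
      rw [← ENNReal.rpow_mul, ENNReal.ofReal_rpow_of_nonneg (by positivity) (by positivity),
        ← Real.rpow_mul (by positivity)]
      congr 2
      field_simp

/-! ### Boundedness of the embedding -/

theorem eLpNorm_dyadicMeasure {p : ℝ} (hp : 0 < p) (s : ℝ) (f : ℂ → ℂ) :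
    eLpNorm f (ENNReal.ofReal p) (dyadicMeasure s) =
      (∑' n : ℕ, ENNReal.ofReal (((n : ℝ) + 1) ^ (-s) / 2 ^ n) *
        ‖f (dyadicRadius n)‖ₑ ^ p) ^ (1 / p) := by
  rw [eLpNorm_eq_lintegral_rpow_enorm_toReal (by simpa using hp) ENNReal.ofReal_ne_top,
    ENNReal.toReal_ofReal hp.le, lintegral_dyadicMeasure]

theorem aestronglyMeasurable_dyadicMeasure (s : ℝ) (f : ℂ → ℂ) :
    AEStronglyMeasurable f (dyadicMeasure s) := by
  refine aestronglyMeasurable_sum_measure_iff.2 fun n => ?_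
  exact aestronglyMeasurable_dirac.smul_measure _

/-- The growth bound to the power `p` contributes `2^n`, cancelling the `2^{-n}` in the weight; what
remains is `∑ (n+1)^{-p/q}` with `p/q = p - 1 > 1`. -/
theorem eLpNorm_dyadicMeasure_le_hardyENorm {p q : ℝ} (hp : 2 < p) (hpq : p.HolderConjugate q) :
    ∃ K : ℝ≥0, ∀ f : ℂ → ℂ, DifferentiableOn ℂ f (ball 0 1) →
      eLpNorm f (ENNReal.ofReal p) (dyadicMeasure (p / q)) ≤
        K * hardyENorm (ENNReal.ofReal p) f := by
  have hp0 : 0 < p := by linarith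
  have hs : 1 < p / q := by rw [hpq.div_conj_eq_sub_one]; linarith
  obtain ⟨K, hK⟩ := enorm_apply_dyadicRadius_le hp hpq
  refine ⟨(∑' n : ℕ, ENNReal.ofReal (((n : ℝ) + 1) ^ (-(p / q)))).toNNReal ^ (1 / p) * K,
    fun f hf => ?_⟩
  have hi : (0 : ℝ) ≤ 1 / p := by positivity
  rw [eLpNorm_dyadicMeasure hp0, ENNReal.coe_mul, ENNReal.coe_rpow_of_nonneg _ hi,
    ENNReal.coe_toNNReal (tsum_ofReal_rpow_neg_lt_top hs).ne, mul_assoc]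
  calc _ ≤ (∑' n : ℕ, ENNReal.ofReal (((n : ℝ) + 1) ^ (-(p / q))) *
        (K * hardyENorm (ENNReal.ofReal p) f) ^ p) ^ (1 / p) := by
        refine ENNReal.rpow_le_rpow (ENNReal.tsum_le_tsum fun n => ?_) hi
        calc _ ≤ ENNReal.ofReal (((n : ℝ) + 1) ^ (-(p / q)) / 2 ^ n) *
              (ENNReal.ofReal (((2 : ℝ) ^ n) ^ (1 / p)) *
                (K * hardyENorm (ENNReal.ofReal p) f)) ^ p := by
              gcongr
              exact (hK f hf n).trans_eq (by ring)
          _ = _ := by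
              rw [ENNReal.mul_rpow_of_nonneg _ _ hp0.le, ← mul_assoc,
                ENNReal.ofReal_rpow_of_nonneg (by positivity) hp0.le,
                ← ENNReal.ofReal_mul (by positivity), ← Real.rpow_mul (by positivity),
                one_div_mul_cancel hp0.ne', Real.rpow_one, div_mul_cancel₀ _ (by positivity)]
    _ = _ := by
        rw [ENNReal.tsum_mul_right, ENNReal.mul_rpow_of_nonneg _ _ hi, ← ENNReal.rpow_mul,
          mul_one_div_cancel hp0.ne', ENNReal.rpow_one]

theorem exists_isCarlesonEmbedding_of_eLpNorm_le {p : ℝ≥0∞} [Fact (1 ≤ p)] {μ : Measure ℂ} (K : ℝ≥0)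
    (hm : ∀ f : HardySpace p, AEStronglyMeasurable f μ)
    (hK : ∀ f : HardySpace p, eLpNorm f p μ ≤ K * hardyENorm p f) :
    ∃ J : HardySpace p →L[ℂ] Lp ℂ p μ, IsCarlesonEmbedding J := by
  have hfin : ∀ f : HardySpace p, hardyENorm p f < ∞ := fun f => f.property.2.2
  have hLp : ∀ f : HardySpace p, MemLp f p μ := fun f =>
    ⟨hm f, (hK f).trans_lt (ENNReal.mul_lt_top ENNReal.coe_lt_top (hfin f))⟩
  refine ⟨LinearMap.mkContinuous
    { toFun := fun f => (hLp f).toLp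
      map_add' := fun f g => (hLp f).toLp_add (hLp g)
      map_smul' := fun c f => (hLp f).toLp_const_smul c } K fun f => ?_, fun f => ?_⟩
  · change ‖(hLp f).toLp‖ ≤ K * (hardyENorm p f).toReal
    rw [Lp.norm_toLp]
    refine (ENNReal.toReal_mono (ENNReal.mul_ne_top ENNReal.coe_ne_top (hfin f).ne)
      (hK f)).trans_eq ?_
    rw [ENNReal.toReal_mul, ENNReal.coe_toReal]
  · exact (hLp f).coeFn_toLp

/-! ### Failure of summability -/

/-- An upper `ℓ^p` estimate is dual to a weak `ℓ^q` bound: the adjoint of `c ↦ ∑ c_i x_i` sends `φ`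
to `(φ (x_i))`. -/
theorem sum_enorm_dual_apply_rpow_le {X ι : Type*} [NormedAddCommGroup X] [NormedSpace ℂ X]
    [Fintype ι] {p q : ℝ} (hpq : p.HolderConjugate q) {x : ι → X} {K : ℝ}
    (hx : ∀ c : ι → ℂ, ‖∑ i, c i • x i‖ ≤ K * (∑ i, ‖c i‖ ^ p) ^ (1 / p))
    {φ : StrongDual ℂ X} (hφ : φ ∈ closedBall (0 : StrongDual ℂ X) 1) :
    (∑ i, ‖φ (x i)‖ₑ ^ q) ^ (1 / q) ≤ ENNReal.ofReal K := by
  have hp0 := hpq.pos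
  have hq0 := hpq.symm.pos
  have hpq' : 1 / p + 1 / q = 1 := by simpa using hpq.inv_add_inv_eq_one
  set S : ℝ := ∑ i, ‖φ (x i)‖ ^ q with hS
  have hS0 : 0 ≤ S := Finset.sum_nonneg fun i _ => by positivity
  have hE : (∑ i, ‖φ (x i)‖ₑ ^ q) ^ (1 / q) = ENNReal.ofReal (S ^ (1 / q)) := by
    rw [← ENNReal.ofReal_rpow_of_nonneg hS0 (by positivity), hS,
      ENNReal.ofReal_sum_of_nonneg fun i _ => by positivity]
    congr 1
    refine Finset.sum_congr rfl fun i _ => ?_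
    rw [← ofReal_norm, ENNReal.ofReal_rpow_of_nonneg (norm_nonneg _) hq0.le]
  rw [hE]
  rcases hS0.eq_or_lt with h0 | hpos
  · rw [← h0, Real.zero_rpow (by positivity)]; simp
  refine ENNReal.ofReal_le_ofReal ?_
  -- The extremal coefficients in Hölder: `c_i φ(x_i) = |φ(x_i)|^q = |c_i|^p`. Hence `S ≤ K
  -- S^{1/p}`, and dividing by `S^{1/p}`, nonzero here, leaves `S^{1/q} ≤ K`.
  set c : ι → ℂ := fun i => (starRingEnd ℂ) (φ (x i)) * ((‖φ (x i)‖ ^ (q - 2) : ℝ) : ℂ) with hc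
  have hcφ : ∀ i, c i * φ (x i) = ((‖φ (x i)‖ ^ q : ℝ) : ℂ) := by
    intro i
    by_cases hz : φ (x i) = 0
    · simp [hz, Real.zero_rpow hq0.ne']
    · have hn : 0 < ‖φ (x i)‖ := norm_pos_iff.2 hz
      have e : ‖φ (x i)‖ ^ q = ‖φ (x i)‖ ^ 2 * ‖φ (x i)‖ ^ (q - 2) := by
        rw [← Real.rpow_natCast, ← Real.rpow_add hn]; congr 1; push_cast; ring
      rw [e]
      push_cast
      rw [← Complex.conj_mul']
      simp only [hc]
      ring
  have hcn : ∀ i, ‖c i‖ ^ p = ‖φ (x i)‖ ^ q := by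
    intro i
    by_cases hz : φ (x i) = 0
    · simp [hc, hz, Real.zero_rpow hq0.ne', Real.zero_rpow hp0.ne']
    · have hn : 0 < ‖φ (x i)‖ := norm_pos_iff.2 hz
      simp only [hc]
      rw [norm_mul, RCLike.norm_conj, Complex.norm_real, Real.norm_of_nonneg (by positivity),
        ← Real.rpow_one_add' hn.le (by linarith [hpq.symm.lt]), ← Real.rpow_mul hn.le]
      congr 1
      rw [show 1 + (q - 2) = q - 1 by ring, hpq.symm.sub_one_mul_conj]
  have h1 : S = ‖φ (∑ i, c i • x i)‖ := by
    simp only [map_sum, map_smul, smul_eq_mul, hcφ]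
    rw [← Complex.ofReal_sum, Complex.norm_real, Real.norm_of_nonneg hS0]
  have h2 : S ≤ K * S ^ (1 / p) := by
    have h3 := hx c
    simp only [hcn] at h3
    calc S = ‖φ (∑ i, c i • x i)‖ := h1
      _ ≤ ‖φ‖ * ‖∑ i, c i • x i‖ := φ.le_opNorm _
      _ ≤ 1 * ‖∑ i, c i • x i‖ := by gcongr; simpa using hφ
      _ ≤ _ := by rwa [one_mul]
  have h4 : S = S ^ (1 / q) * S ^ (1 / p) := by
    rw [← Real.rpow_add hpos, add_comm, hpq', Real.rpow_one]
  exact le_of_mul_le_mul_right (h4.symm.trans_le h2) (by positivity)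

theorem hardyENorm_szegoKernel_lt_top {p q : ℝ} (hp : 2 < p) (hpq : p.HolderConjugate q) (k : ℕ) :
    hardyENorm (ENNReal.ofReal p) (szegoKernel q k) < ∞ := by
  have hp0 : 0 < p := by linarith
  obtain ⟨K, hK⟩ := hardyENorm_sum_szegoKernel_le hp hpq
  have h := hK (k + 1) (Pi.single k 1)
  rw [Finset.sum_eq_single_of_mem k (by simp) fun j _ hj => by simp [hj], Pi.single_eq_same,
    one_smul] at h
  refine h.trans_lt (ENNReal.mul_lt_top ENNReal.coe_lt_top
    (ENNReal.rpow_lt_top_of_nonneg (by positivity) (ENNReal.sum_lt_top.2 fun i _ => ?_).ne))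
  exact ENNReal.rpow_lt_top_of_nonneg hp0.le enorm_ne_top

/-- Only the atom at the kernel's own radius is kept. The powers of `2^k` cancel, leaving
`(k+1)^{-1/q} / 2` before the power `q`; the weight exponent `p/q` was chosen to produce the
harmonic series. -/
theorem enorm_carlesonEmbedding_szegoKernel {p q : ℝ} (hpq : p.HolderConjugate q) (k : ℕ) :
    ENNReal.ofReal ((1 / 2) ^ q * (1 / ((k : ℝ) + 1))) ≤
      eLpNorm (szegoKernel q k) (ENNReal.ofReal p) (dyadicMeasure (p / q)) ^ q := by
  have hp0 := hpq.pos
  have hq0 := hpq.symm.pos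
  have h2k : (0 : ℝ) < 2 ^ k := by positivity
  have hi : (0 : ℝ) ≤ 1 / p := by positivity
  have hk1 : (0 : ℝ) < (k : ℝ) + 1 := by positivity
  have key : ENNReal.ofReal (1 / 2 * ((k : ℝ) + 1) ^ (-(1 / q))) ≤
      eLpNorm (szegoKernel q k) (ENNReal.ofReal p) (dyadicMeasure (p / q)) := by
    rw [eLpNorm_dyadicMeasure hp0]
    calc _ = (ENNReal.ofReal (((k : ℝ) + 1) ^ (-(p / q)) / 2 ^ k) *
          ENNReal.ofReal (1 / 2 * ((2 : ℝ) ^ k) ^ (1 / p)) ^ p) ^ (1 / p) := by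
          rw [ENNReal.mul_rpow_of_nonneg _ _ hi, ← ENNReal.rpow_mul, mul_one_div_cancel hp0.ne',
            ENNReal.rpow_one, ENNReal.ofReal_rpow_of_nonneg (by positivity) hi,
            ← ENNReal.ofReal_mul (by positivity), Real.div_rpow (by positivity) h2k.le,
            ← Real.rpow_mul hk1.le]
          congr 1
          rw [show -(p / q) * (1 / p) = -(1 / q) by field_simp]
          have : ((2 : ℝ) ^ k) ^ (1 / p) ≠ 0 := by positivity
          field_simp
      _ ≤ (ENNReal.ofReal (((k : ℝ) + 1) ^ (-(p / q)) / 2 ^ k) *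
          ‖szegoKernel q k (dyadicRadius k)‖ₑ ^ p) ^ (1 / p) := by
          gcongr
          exact szegoKernel_apply_dyadicRadius hpq k
      _ ≤ _ := by
          refine ENNReal.rpow_le_rpow ?_ hi
          exact ENNReal.le_tsum (f := fun n : ℕ => ENNReal.ofReal (((n : ℝ) + 1) ^ (-(p / q)) / 2 ^ n) *
            ‖szegoKernel q k (dyadicRadius n)‖ₑ ^ p) k
  refine le_trans (le_of_eq ?_) (ENNReal.rpow_le_rpow key hq0.le)
  rw [ENNReal.ofReal_rpow_of_nonneg (by positivity) hq0.le,
    Real.mul_rpow (by norm_num) (by positivity), ← Real.rpow_mul hk1.le,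
    show -(1 / q) * q = -1 by field_simp, Real.rpow_neg_one, one_div ((k : ℝ) + 1)]

/-- The normalized Szegő kernels as elements of `H^p`. -/
noncomputable def szegoHardy {p q : ℝ} [Fact (1 ≤ ENNReal.ofReal p)] (hp : 2 < p)
    (hpq : p.HolderConjugate q) (k : ℕ) : HardySpace (ENNReal.ofReal p) :=
  ⟨szegoKernel q k, szegoKernel_differentiableOn q k, fun _ => szegoKernel_of_notMem q k,
    hardyENorm_szegoKernel_lt_top hp hpq k⟩

theorem HardySpace.toFun_sum_smul {p : ℝ≥0∞} [Fact (1 ≤ p)] {ι : Type*} (s : Finset ι) (c : ι → ℂ)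
    (f : ι → HardySpace p) : (∑ i ∈ s, c i • f i).toFun = ∑ i ∈ s, c i • (f i).toFun := by
  let L : HardySpace p →ₗ[ℂ] (ℂ → ℂ) := (hardySubmodule p).subtype
  change L (∑ i ∈ s, c i • f i) = ∑ i ∈ s, c i • L (f i)
  simp only [map_sum, map_smul]

theorem norm_sum_szegoHardy_le {p q : ℝ} [Fact (1 ≤ ENNReal.ofReal p)] (hp : 2 < p)
    (hpq : p.HolderConjugate q) :
    ∃ K : ℝ≥0, ∀ (N : ℕ) (c : Fin N → ℂ),
      ‖∑ i, c i • szegoHardy hp hpq i‖ ≤ K * (∑ i, ‖c i‖ ^ p) ^ (1 / p) := by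
  have hp0 : 0 < p := by linarith
  obtain ⟨K, hK⟩ := hardyENorm_sum_szegoKernel_le hp hpq
  refine ⟨K, fun N c => ?_⟩
  set d : ℕ → ℂ := fun k => if h : k < N then c ⟨k, h⟩ else 0 with hd
  have hdc : ∀ i : Fin N, d i = c i := fun i => by simp [hd]
  have h := hK N d
  simp only [Finset.sum_range, hdc] at h
  change (hardyENorm _ (∑ i, c i • szegoHardy hp hpq i).toFun).toReal ≤ _
  rw [HardySpace.toFun_sum_smul]
  refine ENNReal.toReal_le_of_le_ofReal (by positivity) (h.trans_eq ?_)
  rw [ENNReal.ofReal_mul (by positivity), ENNReal.ofReal_coe_nnreal,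
    ← ENNReal.ofReal_rpow_of_nonneg (by positivity) (by positivity),
    ENNReal.ofReal_sum_of_nonneg fun i _ => by positivity]
  congr 2
  refine Finset.sum_congr rfl fun i _ => ?_
  rw [← ofReal_norm, ENNReal.ofReal_rpow_of_nonneg (norm_nonneg _) hp0.le]

theorem not_isSumming_carlesonEmbedding {p q : ℝ} (hp : 2 < p) (hpq : p.HolderConjugate q)
    [Fact (1 ≤ ENNReal.ofReal p)]
    (J : HardySpace (ENNReal.ofReal p) →L[ℂ] Lp ℂ (ENNReal.ofReal p) (dyadicMeasure (p / q)))
    (hJ : IsCarlesonEmbedding J) : ¬ IsSumming q J := by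
  rintro ⟨C, hC⟩
  have hq0 := hpq.symm.pos
  obtain ⟨K, hweak⟩ := norm_sum_szegoHardy_le hp hpq
  have hJe : ∀ k : ℕ, ENNReal.ofReal ((1 / 2) ^ q * (1 / ((k : ℝ) + 1))) ≤ ‖J (szegoHardy hp hpq k)‖ₑ ^ q := by
    intro k
    rw [Lp.enorm_def, eLpNorm_congr_ae (hJ (szegoHardy hp hpq k))]
    exact enorm_carlesonEmbedding_szegoKernel hpq k
  -- A summing constant `C` and the weak bound `K` would keep all harmonic partial sums below a
  -- fixed number.
  have hbound : ∀ N : ℕ,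
      ∑ k ∈ Finset.range N, 1 / ((k : ℝ) + 1) ≤ ((C : ℝ) * K) ^ q / (1 / 2) ^ q := by
    intro N
    have hdual : ∀ φ ∈ closedBall (0 : StrongDual ℂ (HardySpace (ENNReal.ofReal p))) 1,
        (∑ j : Fin N, ‖φ (szegoHardy hp hpq j)‖ₑ ^ q) ^ (1 / q) ≤ ENNReal.ofReal K :=
      fun φ hφ => sum_enorm_dual_apply_rpow_le (x := fun j : Fin N => szegoHardy hp hpq j)
        hpq (hweak N) hφ
    have h1 : (∑ j : Fin N, ‖J (szegoHardy hp hpq j)‖ₑ ^ q) ^ (1 / q) ≤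
        C * ENNReal.ofReal K := by
      refine (hC N fun j => szegoHardy hp hpq j).trans ?_
      gcongr
      exact iSup₂_le hdual
    have h2 : ENNReal.ofReal (∑ k ∈ Finset.range N, (1 / 2) ^ q * (1 / ((k : ℝ) + 1))) ≤
        ENNReal.ofReal (((C : ℝ) * K) ^ q) := by
      calc _ ≤ ∑ j : Fin N, ‖J (szegoHardy hp hpq j)‖ₑ ^ q := by
            rw [ENNReal.ofReal_sum_of_nonneg fun k _ => by positivity, Finset.sum_range]
            exact Finset.sum_le_sum fun j _ => hJe j
        _ = ((∑ j : Fin N, ‖J (szegoHardy hp hpq j)‖ₑ ^ q) ^ (1 / q)) ^ q := by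
            rw [← ENNReal.rpow_mul, one_div_mul_cancel hq0.ne', ENNReal.rpow_one]
        _ ≤ (C * ENNReal.ofReal K) ^ q := by gcongr
        _ = _ := by
            rw [← ENNReal.ofReal_coe_nnreal, ← ENNReal.ofReal_mul (by positivity),
              ENNReal.ofReal_rpow_of_nonneg (by positivity) hq0.le]
    rw [ENNReal.ofReal_le_ofReal_iff (by positivity), ← Finset.mul_sum] at h2
    rwa [le_div_iff₀ (by positivity), mul_comm]
  obtain ⟨N, hN⟩ := (Real.tendsto_sum_range_one_div_nat_succ_atTop.eventually_gt_atTop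
    (((C : ℝ) * K) ^ q / (1 / 2) ^ q)).exists
  exact (hbound N).not_gt hN

theorem mainTheorem12 (p q : ℝ) (hp : 2 < p) (hpq : p.HolderConjugate q)
    [Fact (1 ≤ ENNReal.ofReal p)] :
    ∃ μ : Measure ℂ, IsFiniteMeasure μ ∧
      μ ((fun t : ℝ => (t : ℂ)) '' Ico (0 : ℝ) 1)ᶜ = 0 ∧
      (∑' n : ℕ, (∑ j ∈ Finset.range (2 ^ n),
        (2 ^ n * μ (lueckingBox n j)) ^ (q / p)) ^ (2 / q)) ^ (1 / 2 : ℝ) < ∞ ∧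
      ∃ J : HardySpace (ENNReal.ofReal p) →L[ℂ] Lp ℂ (ENNReal.ofReal p) μ,
        IsCarlesonEmbedding J ∧ ¬ IsSumming q J := by
  obtain ⟨K, hK⟩ := eLpNorm_dyadicMeasure_le_hardyENorm hp hpq
  obtain ⟨J, hJ⟩ := exists_isCarlesonEmbedding_of_eLpNorm_le (p := ENNReal.ofReal p)
    (μ := dyadicMeasure (p / q)) K (fun f => aestronglyMeasurable_dyadicMeasure _ _)
    fun f => hK f f.property.1
  exact ⟨dyadicMeasure (p / q),
    isFiniteMeasure_dyadicMeasure (by rw [hpq.div_conj_eq_sub_one]; linarith),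
    dyadicMeasure_compl_segment _, tsum_lueckingBox_lt_top hp hpq, J, hJ,
    not_isSumming_carlesonEmbedding hp hpq J hJ⟩
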